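/- Let $k$ be a field, let $n \ge 3$ and $t \ge 1$ be integers, and let $R = k[x_1,\dots,x_n]$ with the standard grading. For a homogeneous ideal $I \subseteq R$ and $d \ge 0$ let $I_{\langle d\rangle}$ be the ideal generated by the homogeneous elements of degree $d$ in $I$. The ideal $I$ is called componentwise linear if for every $d \ge 0$ the ideal $I_{\langle d\rangle}$ has a linear resolution, that is, a minimal graded free resolution $\cdots \to F_1 \to F_0 \to I_{\langle d\rangle} \to 0$ in which each $F_i$ is a finite direct sum (possibly zero) of copies of $R(-d-i)$. Then the ideal $$K_n^{(t)} = \bigcap_{1 \le i < j \le n} \langle x_i, x_j\rangle^t \subseteq R$$ is componentwise linear. -/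

import Mathlib

/-- A graded free resolution `⋯ → F₂ → F₁ → F₀ → J → 0` of an ideal `J` of the standard graded
polynomial ring `k[x_v : v ∈ σ]`.  The module `F i = ⨁_{b ∈ basis i} R(-twist i b)` is free on the
finite set `basis i`, whose element `b` is placed in degree `twist i b`; the differentials are
given by matrices in these bases, and all maps are homogeneous of degree `0`. -/
structure GradedFreeResolution {k σ : Type*} [Field k] (J : Ideal (MvPolynomial σ k)) where
  /-- The index set of the basis of `F i`. -/
  basis : ℕ → Type
  /-- Each `F i` has finite rank. -/
  [fintypeBasis : ∀ i, Fintype (basis i)]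
  /-- The degrees of the basis elements of `F i`. -/
  twist : ∀ i, basis i → ℤ
  /-- The images of the basis elements of `F 0` in `J`. -/
  gen : basis 0 → MvPolynomial σ k
  /-- The matrix of the differential `F (i + 1) → F i`. -/
  diff : ∀ i, Matrix (basis i) (basis (i + 1)) (MvPolynomial σ k)
  /-- The map `F 0 → J` is homogeneous of degree `0`. -/
  gen_homogeneous : ∀ b, gen b = 0 ∨
    ∃ e : ℕ, twist 0 b = e ∧ (gen b).IsHomogeneous e
  /-- The differentials are homogeneous of degree `0`. -/
  diff_homogeneous : ∀ i b c, diff i b c = 0 ∨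
    ∃ e : ℕ, twist (i + 1) c = twist i b + e ∧ (diff i b c).IsHomogeneous e
  /-- The map `F 0 → J` is well defined and surjective. -/
  span_gen : Ideal.span (Set.range gen) = J
  /-- Exactness at `F 0`. -/
  exact_zero : Function.Exact (fun v => (diff 0).mulVec v) (fun v => ∑ b, v b * gen b)
  /-- Exactness at `F (i + 1)`. -/
  exact_succ : ∀ i, Function.Exact (fun v => (diff (i + 1)).mulVec v)
    (fun v => (diff i).mulVec v)

/-- The resolution is minimal: all entries of the differentials lie in the ideal generated by
the variables. -/
def GradedFreeResolution.IsMinimal {k σ : Type*} [Field k] {J : Ideal (MvPolynomial σ k)}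
    (F : GradedFreeResolution J) : Prop :=
  ∀ i b c, F.diff i b c ∈ Ideal.span (Set.range (MvPolynomial.X : σ → MvPolynomial σ k))

/-- The resolution is `d`-linear: `F i` is a direct sum of copies of `R(-d-i)` for every `i`. -/
def GradedFreeResolution.IsLinear {k σ : Type*} [Field k] {J : Ideal (MvPolynomial σ k)}
    (F : GradedFreeResolution J) (d : ℕ) : Prop :=
  ∀ i b, F.twist i b = (d : ℤ) + (i : ℤ)

/-- The ideal `J` (generated in degree `d`) has a linear resolution: it has a minimal graded free
resolution which is `d`-linear. -/
def HasLinearResolution {k σ : Type*} [Field k] (J : Ideal (MvPolynomial σ k)) (d : ℕ) : Prop :=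
  ∃ F : GradedFreeResolution J, F.IsMinimal ∧ F.IsLinear d

/-- The ideal `I_⟨d⟩` generated by the homogeneous elements of degree `d` that belong to `I`. -/
noncomputable def degreeComponentIdeal {k σ : Type*} [Field k] (I : Ideal (MvPolynomial σ k)) (d : ℕ) :
    Ideal (MvPolynomial σ k) :=
  Ideal.span {f | f ∈ I ∧ f.IsHomogeneous d}

attribute [local instance] MvPolynomial.gradedAlgebra

/-- A graded ideal `I` is componentwise linear if `I_⟨d⟩` has a linear resolution for all `d`. -/
def IsComponentwiseLinear {k σ : Type*} [Field k] (I : Ideal (MvPolynomial σ k)) : Prop :=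
  I.IsHomogeneous (MvPolynomial.homogeneousSubmodule σ k) ∧
    ∀ d : ℕ, HasLinearResolution (degreeComponentIdeal I d) d

/-- The ideal `⋂ ⟨x_i, x_j⟩ ^ t`, the intersection being over all edges `{i, j}` of `G`. -/
noncomputable def edgePowerIntersection (k : Type*) {V : Type*} [Field k] (G : SimpleGraph V) (t : ℕ) :
    Ideal (MvPolynomial V k) :=
  ⨅ (i : V) (j : V) (_ : G.Adj i j), Ideal.span {MvPolynomial.X i, MvPolynomial.X j} ^ t

open MvPolynomial

/-! For each `d`, the degree-`d` monomials of the ideal have linear quotients in a suitable order,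
and linear quotients yield a linear resolution.

The order is by the weight `n * Σ a_i ^ 2 + Σ i * a_i`, so balanced exponents come first. If `a ≠ b`
have equal degree and `a` weighs no more than `b`, convexity gives a unit move in `b`, from `l` to
some `s` with `b s < a s`, that strictly lowers the weight (`exists_exchange`). Such a move goes
from a larger entry to a smaller one, so it preserves `t ≤ b i + b j` for all pairs. Hence every
colon ideal is generated by variables.

The resolution is built by iteration. A sequence of vectors whose successive colons are generated by
variables has its syzygies generated by linear ones, one for each pair `(b, s)` with `X s` in the
`b`-th colon; in lexicographic order these again have variable colons
(`IsLeadingSyzygies.hasVariableColons`). -/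

theorem MvPolynomial.homogeneousComponent_add_mul_of_isHomogeneous {σ R : Type*} [CommSemiring R]
    (m : ℕ) {n : ℕ} (p : MvPolynomial σ R) {q : MvPolynomial σ R} (hq : q.IsHomogeneous n) :
    homogeneousComponent (m + n) (p * q) = homogeneousComponent m p * q := by
  have h := DirectSum.coe_decompose_mul_add_of_right_mem (homogeneousSubmodule σ R) (i := m)
    (a := p) ((mem_homogeneousSubmodule n q).2 hq)
  rw [← decomposition.decompose'_apply, ← decomposition.decompose'_apply]
  exact h

/-- A variable outside `S` is a nonzerodivisor modulo the ideal generated by the variables in `S`.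
-/
theorem MvPolynomial.mem_span_X_of_mul_X_mem {σ R : Type*} [CommSemiring R]
    {S : Set σ} {s : σ} (hs : s ∉ S) {f : MvPolynomial σ R}
    (hf : f * X s ∈ Ideal.span (X '' S)) : f ∈ Ideal.span (X '' S) := by
  classical
  rw [mem_ideal_span_X_image] at hf ⊢
  intro m hm
  obtain ⟨i, hi, h⟩ := hf (m + Finsupp.single s 1) (by
    rw [mem_support_iff, coeff_mul_X]; exact mem_support_iff.1 hm)
  refine ⟨i, hi, ?_⟩
  have : s ≠ i := fun h => hs (h ▸ hi)
  simpa [Finsupp.single_apply, this] using h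

/-! ### Syzygies of sequences with variable colons -/

section VariableColons

variable {k σ ι κ : Type*} [Field k] [LinearOrder ι]

/-- The colon modules `(span (g '' Iio b) : g b)` of the sequence `g` are the ideals generated by
the variables `X s`, `s ∈ S b`. -/
def HasVariableColons (g : ι → κ → MvPolynomial σ k) (S : ι → Set σ) : Prop :=
  ∀ (b : ι) (f : MvPolynomial σ k), f • g b ∈ Submodule.span (MvPolynomial σ k) (g '' Set.Iio b) ↔
    f ∈ Ideal.span (X '' S b)

variable [Fintype ι] {g : ι → κ → MvPolynomial σ k} {S : ι → Set σ}

theorem HasVariableColons.exists_linear_syzygy (h : HasVariableColons g S) {e : ℕ}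
    (hg : ∀ b c, (g b c).IsHomogeneous e) {b : ι} {s : σ} (hs : s ∈ S b) :
    ∃ w : ι → MvPolynomial σ k, (∀ j, (w j).IsHomogeneous 1) ∧ w b = X s ∧
      (∀ j, b < j → w j = 0) ∧ ∑ j, w j • g j = 0 := by
  classical
  have hmem := (h b (X s)).2 (Ideal.subset_span ⟨s, hs, rfl⟩)
  have hset : Set.Iio b = ((Finset.univ.filter (· < b) : Finset ι) : Set ι) := by ext; simp
  rw [hset] at hmem
  obtain ⟨c, hc⟩ := Submodule.mem_span_image_finset_iff_exists_fun' _ |>.1 hmem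
  -- The given coefficients need not be homogeneous; comparing components of degree `1 + e` shows
  -- that their linear parts already form a relation.
  refine ⟨fun j => if j < b then -homogeneousComponent 1 (c j) else if j = b then X s else 0,
    fun j => ?_, by simp, fun j hj => by simp [hj.not_gt, hj.ne'], ?_⟩
  · dsimp only
    split_ifs
    · exact (homogeneousComponent_isHomogeneous 1 (c j)).neg
    · exact isHomogeneous_X k s
    · exact isHomogeneous_zero σ k 1
  · have key : ∑ j with j < b, homogeneousComponent 1 (c j) • g j = (X s : MvPolynomial σ k) • g b := by
      funext r
      have hr := congrArg (homogeneousComponent (1 + e)) (congrFun hc r)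
      simp only [Finset.sum_apply, Pi.smul_apply, smul_eq_mul, map_sum,
        homogeneousComponent_add_mul_of_isHomogeneous 1 (c _) (hg _ r),
        homogeneousComponent_add_mul_of_isHomogeneous 1 (X s) (hg b r)] at hr ⊢
      rw [hr, homogeneousComponent_eq_self (isHomogeneous_X k s)]
    have hsplit : ∀ j, (if j < b then -homogeneousComponent 1 (c j) else
        if j = b then (X s : MvPolynomial σ k) else 0) • g j =
        (if j < b then -(homogeneousComponent 1 (c j) • g j) else 0) +
          if j = b then (X s : MvPolynomial σ k) • g b else 0 := by
      intro j
      rcases lt_trichotomy j b with hj | rfl | hj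
      · simp [hj, hj.ne]
      · simp
      · simp [hj.not_gt, hj.ne']
    rw [Finset.sum_congr rfl fun j _ => hsplit j, Finset.sum_add_distrib, ← Finset.sum_filter,
      Finset.sum_neg_distrib, key]
    simp

/-- The properties of the linear syzygies of a sequence with variable colons, indexed by the pairs
`(b, s)` with `s ∈ S b` in lexicographic order. -/
structure IsLeadingSyzygies [LinearOrder σ] (g : ι → κ → MvPolynomial σ k) (S : ι → Set σ)
    (w : {p : ι ×ₗ σ // (ofLex p).2 ∈ S (ofLex p).1} → ι → MvPolynomial σ k) : Prop where
  leading : ∀ p, w p (ofLex p.1).1 = X (ofLex p.1).2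
  eq_zero : ∀ p j, (ofLex p.1).1 < j → w p j = 0
  relation : ∀ p, ∑ j, w p j • g j = 0

variable [LinearOrder σ] {w : {p : ι ×ₗ σ // (ofLex p).2 ∈ S (ofLex p).1} → ι → MvPolynomial σ k}

/-- Reduction by leading terms: the last coefficient `v b` lies in the colon ideal, so a combination
of the syzygies led by `b` cancels it, and the remainder is supported strictly below `b`. -/
theorem IsLeadingSyzygies.mem_span_of_forall_le (hw : IsLeadingSyzygies g S w)
    (h : HasVariableColons g S) (b : ι) (v : ι → MvPolynomial σ k) (hv : ∑ j, v j • g j = 0)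
    (hb : ∀ j, b < j → v j = 0) :
    v ∈ Submodule.span (MvPolynomial σ k) (w '' {p | (ofLex p.1).1 ≤ b}) := by
  classical
  induction b using WellFoundedLT.induction generalizing v with
  | ind b ih =>
  set W := Submodule.span (MvPolynomial σ k) (w '' {p | (ofLex p.1).1 ≤ b})
  have hWprop : ∀ u ∈ W, (∑ j, u j • g j = 0) ∧ ∀ j, b < j → u j = 0 := by
    intro u hu
    induction hu using Submodule.span_induction with
    | mem u hu =>
      obtain ⟨p, hp, rfl⟩ := hu
      exact ⟨hw.relation p, fun j hj => hw.eq_zero p j (lt_of_le_of_lt hp hj)⟩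
    | zero => simp
    | add u u' _ _ h1 h2 =>
      refine ⟨by simp [add_smul, Finset.sum_add_distrib, h1.1, h2.1], fun j hj => ?_⟩
      simp [h1.2 j hj, h2.2 j hj]
    | smul a u _ h1 =>
      refine ⟨by simp [mul_smul, ← Finset.smul_sum, h1.1], fun j hj => ?_⟩
      simp [h1.2 j hj]
  have hcol : v b ∈ Ideal.span (X '' S b) := by
    rw [← h b]
    have h1 : v b • g b = -∑ j ∈ Finset.univ.erase b, v j • g j := by
      rw [eq_neg_iff_add_eq_zero, Finset.add_sum_erase _ (fun j => v j • g j) (Finset.mem_univ b), hv]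
    rw [h1]
    refine Submodule.neg_mem _ (Submodule.sum_mem _ fun j hj => ?_)
    rcases lt_or_gt_of_ne (Finset.ne_of_mem_erase hj) with hlt | hlt
    · exact Submodule.smul_mem _ _ (Submodule.subset_span ⟨j, hlt, rfl⟩)
    · simp [hb j hlt]
  have hle : Ideal.span (X '' S b) ≤ W.map (LinearMap.proj b) := by
    refine Submodule.span_le.2 ?_
    rintro _ ⟨s, hs, rfl⟩
    exact ⟨w ⟨toLex (b, s), hs⟩, Submodule.subset_span ⟨_, le_refl b, rfl⟩,
      hw.leading ⟨toLex (b, s), hs⟩⟩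
  obtain ⟨u, hu, hub⟩ := hle hcol
  have hub : u b = v b := hub
  rw [← sub_add_cancel v u]
  refine W.add_mem ?_ hu
  by_cases h0 : v - u = 0
  · rw [h0]; exact W.zero_mem
  set T := Finset.univ.filter fun j => (v - u) j ≠ 0
  have hT : T.Nonempty := by
    obtain ⟨j, hj⟩ := Function.ne_iff.1 h0
    exact ⟨j, by simpa [T] using hj⟩
  have hmax := T.max'_mem hT
  have hlt : T.max' hT < b := by
    by_contra hcon
    have hne : (v - u) (T.max' hT) ≠ 0 := by simpa [T] using hmax
    rcases (not_lt.1 hcon).eq_or_lt with he | hl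
    · exact hne (by rw [← he]; simp [hub])
    · exact hne (by simp [hb _ hl, (hWprop u hu).2 _ hl])
  refine Submodule.span_mono (Set.image_mono fun p hp => le_trans hp hlt.le)
    (ih _ hlt (v - u) ?_ fun j hj => ?_)
  · simp [sub_smul, Finset.sum_sub_distrib, hv, (hWprop u hu).1]
  · by_contra hne
    exact absurd (T.le_max' j (by simpa [T] using hne)) (not_le.2 hj)

theorem IsLeadingSyzygies.mem_span_of_forall_lt (hw : IsLeadingSyzygies g S w)
    (h : HasVariableColons g S) (b : ι) (v : ι → MvPolynomial σ k) (hv : ∑ j, v j • g j = 0)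
    (hb : ∀ j, b ≤ j → v j = 0) :
    v ∈ Submodule.span (MvPolynomial σ k) (w '' {p | (ofLex p.1).1 < b}) := by
  classical
  by_cases hne : (Finset.univ.filter (· < b)).Nonempty
  · have hmem := (Finset.univ.filter (· < b)).max'_mem hne
    set c := (Finset.univ.filter (· < b)).max' hne
    refine Submodule.span_mono (Set.image_mono fun p hp => ?_)
      (hw.mem_span_of_forall_le h c v hv fun j hj => hb j ?_)
    · exact lt_of_le_of_lt hp (by simpa using hmem)
    · by_contra hcon
      exact absurd (Finset.le_max' _ j (by simpa using hcon)) (not_le.2 hj)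
  · have : v = 0 := by
      funext j
      refine hb j (not_lt.1 fun hj => hne ⟨j, by simpa using hj⟩)
    rw [this]
    exact Submodule.zero_mem _

theorem IsLeadingSyzygies.mem_span_range (hw : IsLeadingSyzygies g S w)
    (h : HasVariableColons g S) (v : ι → MvPolynomial σ k) (hv : ∑ j, v j • g j = 0) :
    v ∈ Submodule.span (MvPolynomial σ k) (Set.range w) := by
  rcases isEmpty_or_nonempty ι with hι | hι
  · rw [Subsingleton.elim v 0]
    exact Submodule.zero_mem _
  · refine Submodule.span_mono (Set.image_subset_range _ _)
      (hw.mem_span_of_forall_le h (Finset.univ.max' Finset.univ_nonempty) v hv fun j hj => ?_)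
    exact absurd (Finset.le_max' _ j (Finset.mem_univ j)) (not_le.2 hj)

/-- Coordinate `b` shows that nothing beyond these variables occurs: there, earlier syzygies are `0`
or `X s'` with `s' < s`. Conversely, `X s' • w (b, s) - X s • w (b, s')` vanishes at `b`, hence is
generated by syzygies led below `b`, which come earlier. -/
theorem IsLeadingSyzygies.hasVariableColons (hw : IsLeadingSyzygies g S w)
    (h : HasVariableColons g S) :
    HasVariableColons w fun p => {s | s ∈ S (ofLex p.1).1 ∧ s < (ofLex p.1).2} := by
  intro p f
  obtain ⟨p, hp⟩ := p
  obtain ⟨⟨b, s⟩, rfl⟩ := toLex.surjective p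
  simp only [ofLex_toLex] at hp ⊢
  constructor
  · intro hf
    refine mem_span_X_of_mul_X_mem (s := s) (fun h => lt_irrefl _ h.2) ?_
    have hle : Submodule.span (MvPolynomial σ k) (w '' Set.Iio ⟨toLex (b, s), hp⟩) ≤
        Submodule.comap (LinearMap.proj b : (ι → MvPolynomial σ k) →ₗ[MvPolynomial σ k] _)
          (Ideal.span (X '' {s' | s' ∈ S b ∧ s' < s})) := by
      refine Submodule.span_le.2 ?_
      rintro _ ⟨⟨q, hq⟩, hlt, rfl⟩
      obtain ⟨⟨b', s'⟩, rfl⟩ := toLex.surjective q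
      have hlt : toLex (b', s') < toLex (b, s) := hlt
      rcases Prod.Lex.toLex_lt_toLex.1 hlt with hb | ⟨rfl, hs⟩
      · have : w ⟨toLex (b', s'), hq⟩ b = 0 := hw.eq_zero _ b hb
        simp [this]
      · have : w ⟨toLex (b', s'), hq⟩ b' = X s' := hw.leading ⟨toLex (b', s'), hq⟩
        simp only [Submodule.comap_coe, Set.mem_preimage, LinearMap.coe_proj, Function.eval, this]
        exact Ideal.subset_span ⟨s', ⟨hq, hs⟩, rfl⟩
    have := hle hf
    have hl : w ⟨toLex (b, s), hp⟩ b = X s := hw.leading ⟨toLex (b, s), hp⟩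
    simpa [hl] using this
  · intro hf
    induction hf using Submodule.span_induction with
    | zero => simp
    | add x y _ _ hx hy => rw [add_smul]; exact Submodule.add_mem _ hx hy
    | smul a x _ hx => rw [smul_assoc]; exact Submodule.smul_mem _ _ hx
    | mem x hx =>
      obtain ⟨s', ⟨hs', hlt⟩, rfl⟩ := hx
      set w1 := w ⟨toLex (b, s), hp⟩ with hw1
      set w2 := w ⟨toLex (b, s'), hs'⟩ with hw2
      rw [← sub_add_cancel ((X s' : MvPolynomial σ k) • w1) ((X s : MvPolynomial σ k) • w2)]
      refine Submodule.add_mem _ (Submodule.span_mono ?_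
        (hw.mem_span_of_forall_lt h b _ ?_ fun j hj => ?_))
        (Submodule.smul_mem _ _ (Submodule.subset_span ⟨_, ?_, rfl⟩))
      · exact Set.image_mono fun q hq => Prod.Lex.toLex_lt_toLex.2 (Or.inl hq)
      · simp only [Pi.sub_apply, Pi.smul_apply, sub_smul, smul_assoc, Finset.sum_sub_distrib,
          ← Finset.smul_sum]
        rw [hw1, hw2, hw.relation, hw.relation]
        simp
      · rcases hj.eq_or_lt with rfl | hj
        · have e1 : w1 b = X s := hw.leading ⟨toLex (b, s), hp⟩
          have e2 : w2 b = X s' := hw.leading ⟨toLex (b, s'), hs'⟩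
          simp [e1, e2, mul_comm]
        · have e1 : w1 j = 0 := hw.eq_zero _ j hj
          have e2 : w2 j = 0 := hw.eq_zero _ j hj
          simp [e1, e2]
      · exact Prod.Lex.toLex_lt_toLex.2 (Or.inr ⟨rfl, hlt⟩)

theorem IsLeadingSyzygies.exact [Fintype {p : ι ×ₗ σ // (ofLex p).2 ∈ S (ofLex p).1}]
    (hw : IsLeadingSyzygies g S w) (h : HasVariableColons g S) :
    Function.Exact (fun v => Matrix.mulVec (fun b p => w p b) v)
      (fun v : ι → MvPolynomial σ k => ∑ b, v b • g b) := by
  have hmul : ∀ v, Matrix.mulVec (fun b p => w p b) v = ∑ p, v p • w p := by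
    intro v
    funext b
    simp [Matrix.mulVec, dotProduct, mul_comm]
  intro v
  simp only [hmul]
  constructor
  · intro hv
    exact Submodule.mem_span_range_iff_exists_fun _ |>.1 (hw.mem_span_range h v hv)
  · rintro ⟨c, rfl⟩
    simp only [Finset.sum_apply, Pi.smul_apply, Finset.sum_smul, smul_assoc]
    rw [Finset.sum_comm]
    exact Finset.sum_eq_zero fun p _ => by rw [← Finset.smul_sum, hw.relation p, smul_zero]

end VariableColons

/-! ### The linear resolution obtained by iterating syzygies -/

section LinearResolution

/-- A bundled finite sequence `elt` of vectors with homogeneous entries of degree `deg`, indexed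
by the linear order `index`, whose colon modules are generated by variables. -/
structure VariableColonSequence (k σ : Type*) [Field k] where
  /-- The coordinates of the vectors. -/
  coord : Type
  /-- The index set of the sequence. -/
  index : Type
  /-- The sequence is finite. -/
  [fintypeIndex : Fintype index]
  /-- The order of the sequence. -/
  [linearOrderIndex : LinearOrder index]
  /-- The degree of the entries. -/
  deg : ℕ
  /-- The vectors of the sequence. -/
  elt : index → coord → MvPolynomial σ k
  /-- The variables generating the colon modules. -/
  colon : index → Set σ
  isHomogeneous_elt : ∀ b c, (elt b c).IsHomogeneous deg
  hasVariableColons : HasVariableColons elt colon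

namespace VariableColonSequence

attribute [instance] fintypeIndex linearOrderIndex

variable {k : Type*} {σ : Type} [Field k]

theorem exists_isLeadingSyzygies [LinearOrder σ] (A : VariableColonSequence k σ) :
    ∃ w : {p : A.index ×ₗ σ // (ofLex p).2 ∈ A.colon (ofLex p).1} → A.index → MvPolynomial σ k,
      (∀ p j, (w p j).IsHomogeneous 1) ∧ IsLeadingSyzygies A.elt A.colon w := by
  choose w h1 h2 h3 h4 using fun p : {p : A.index ×ₗ σ // (ofLex p).2 ∈ A.colon (ofLex p).1} =>
    A.hasVariableColons.exists_linear_syzygy A.isHomogeneous_elt p.2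
  exact ⟨w, h1, h2, h3, h4⟩

variable [LinearOrder σ] [Finite σ]

/-- The sequence of linear syzygies of a sequence with variable colons. -/
noncomputable def syzygies (A : VariableColonSequence k σ) : VariableColonSequence k σ where
  coord := A.index
  index := {p : A.index ×ₗ σ // (ofLex p).2 ∈ A.colon (ofLex p).1}
  fintypeIndex :=
    have : Finite (A.index ×ₗ σ) := inferInstanceAs (Finite (A.index × σ))
    Fintype.ofFinite _
  -- This is the degree of the matrix entries, not the internal degree of the syzygies, which the
  -- twist records separately.
  deg := 1
  elt := A.exists_isLeadingSyzygies.choose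
  colon := fun p => {s | s ∈ A.colon (ofLex p.1).1 ∧ s < (ofLex p.1).2}
  isHomogeneous_elt := A.exists_isLeadingSyzygies.choose_spec.1
  hasVariableColons :=
    A.exists_isLeadingSyzygies.choose_spec.2.hasVariableColons A.hasVariableColons

/-- The iterated syzygy sequences. -/
noncomputable def iterSyzygies (A : VariableColonSequence k σ) (i : ℕ) :
    VariableColonSequence k σ :=
  Nat.rec A (fun _ B => B.syzygies) i

/-- The matrix of the map sending basis vectors to linear syzygies. -/
noncomputable def syzygyMatrix (A : VariableColonSequence k σ) :
    Matrix A.index A.syzygies.index (MvPolynomial σ k) :=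
  fun b p => A.syzygies.elt p b

theorem exact_syzygyMatrix (A : VariableColonSequence k σ) :
    Function.Exact (fun v => A.syzygyMatrix.mulVec v)
      (fun v : A.index → MvPolynomial σ k => ∑ b, v b • A.elt b) :=
  letI : Fintype {p : A.index ×ₗ σ // (ofLex p).2 ∈ A.colon (ofLex p).1} :=
    A.syzygies.fintypeIndex
  IsLeadingSyzygies.exact (ι := A.index) A.exists_isLeadingSyzygies.choose_spec.2
    A.hasVariableColons

theorem syzygyMatrix_mulVec (A : VariableColonSequence k σ)
    (v : A.syzygies.index → MvPolynomial σ k) :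
    A.syzygyMatrix.mulVec v = ∑ p, v p • fun b => A.syzygyMatrix b p := by
  funext b
  simp [Matrix.mulVec, dotProduct, mul_comm]

end VariableColonSequence

open VariableColonSequence

variable {k : Type*} {σ : Type} [Field k] [LinearOrder σ] [Finite σ]

/-- The linear resolution of an ideal generated by a sequence of forms with variable colons. -/
noncomputable def VariableColonSequence.gradedFreeResolution (A : VariableColonSequence k σ)
    (c : A.coord) (hc : ∀ c', c' = c) {J : Ideal (MvPolynomial σ k)}
    (hJ : Ideal.span (Set.range fun b => A.elt b c) = J) : GradedFreeResolution J where
  basis i := (A.iterSyzygies i).index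
  twist i _ := (A.deg : ℤ) + i
  gen b := A.elt b c
  diff i := (A.iterSyzygies i).syzygyMatrix
  gen_homogeneous b := Or.inr ⟨A.deg, by simp, A.isHomogeneous_elt b c⟩
  diff_homogeneous i b p := Or.inr ⟨1, by push_cast; ring,
    (A.iterSyzygies i).syzygies.isHomogeneous_elt p b⟩
  span_gen := hJ
  exact_zero v := by
    refine Iff.trans ?_ (A.exact_syzygyMatrix v)
    simp only [funext_iff, Finset.sum_apply, Pi.smul_apply, smul_eq_mul, Pi.zero_apply]
    exact ⟨fun h c' => hc c' ▸ h, fun h => h c⟩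
  exact_succ i := by
    intro v
    refine Iff.trans ?_ ((A.iterSyzygies (i + 1)).exact_syzygyMatrix v)
    exact (congrArg (· = 0) ((A.iterSyzygies i).syzygyMatrix_mulVec v)).to_iff

theorem VariableColonSequence.hasLinearResolution (A : VariableColonSequence k σ)
    (c : A.coord) (hc : ∀ c', c' = c) {J : Ideal (MvPolynomial σ k)}
    (hJ : Ideal.span (Set.range fun b => A.elt b c) = J) : HasLinearResolution J A.deg := by
  refine ⟨A.gradedFreeResolution c hc hJ, fun i b p => ?_, fun i b => rfl⟩
  have h : ((A.iterSyzygies i).syzygyMatrix b p).IsHomogeneous 1 :=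
    (A.iterSyzygies i).syzygies.isHomogeneous_elt p b
  -- Minimality: linear forms lie in the ideal of the variables.
  rw [← mem_homogeneousSubmodule, homogeneousSubmodule_one_eq_span_X] at h
  exact Submodule.span_le_restrictScalars k _ _ h

end LinearResolution

/-! ### Monomial description of the ideal and its degree components -/

section EdgePowers

variable {k σ : Type*} [Field k]

/-- `⟨X i, X j⟩ ^ t` consists of the polynomials whose monomials all have degree at least `t` in
`X i` and `X j`. -/
theorem MvPolynomial.mem_span_pair_X_pow {i j : σ} (hij : i ≠ j) (t : ℕ) (f : MvPolynomial σ k) :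
    f ∈ Ideal.span {X i, X j} ^ t ↔ ∀ a ∈ f.support, t ≤ a i + a j := by
  classical
  constructor
  · intro hf
    induction t generalizing f with
    | zero => simp
    | succ t ih =>
      rw [pow_succ] at hf
      induction hf using Submodule.mul_induction_on' with
      | mem_mul_mem p hp q hq =>
        intro a ha
        obtain ⟨b, hb, c, hc, rfl⟩ := Finset.mem_add.1 (support_mul p q ha)
        rw [← Set.image_pair, mem_ideal_span_X_image] at hq
        obtain ⟨l, hl, hlc⟩ := hq c hc
        have := ih p hp b hb
        simp only [Finsupp.add_apply]
        rcases hl with rfl | rfl <;> omega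
      | add p _ q _ hp hq =>
        intro a ha
        rcases Finset.mem_union.1 (support_add ha) with h | h
        exacts [hp a h, hq a h]
  · intro hf
    rw [f.as_sum]
    refine Ideal.sum_mem _ fun a ha => ?_
    have hle : Finsupp.single i (a i) + Finsupp.single j (a j) ≤ a := by
      intro l
      by_cases h1 : l = i
      · subst h1; simp [hij.symm]
      · by_cases h2 : l = j
        · subst h2; simp [hij]
        · simp [Ne.symm h1, Ne.symm h2]
    obtain ⟨b, hb⟩ := exists_add_of_le hle
    have hm : monomial a (coeff a f) = monomial b (coeff a f) * (X i ^ a i * X j ^ a j) := by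
      rw [X_pow_eq_monomial, X_pow_eq_monomial, monomial_mul, monomial_mul, mul_one, mul_one,
        add_comm b, ← hb]
    rw [hm]
    refine Ideal.mul_mem_left _ _ (Ideal.pow_le_pow_right (hf a ha) ?_)
    rw [pow_add]
    exact Ideal.mul_mem_mul (Ideal.pow_mem_pow (Ideal.subset_span (by simp)) _)
      (Ideal.pow_mem_pow (Ideal.subset_span (by simp)) _)

theorem mem_edgePowerIntersection {G : SimpleGraph σ} {t : ℕ} {f : MvPolynomial σ k} :
    f ∈ edgePowerIntersection k G t ↔
      ∀ a ∈ f.support, ∀ i j, G.Adj i j → t ≤ a i + a j := by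
  simp only [edgePowerIntersection, Submodule.mem_iInf]
  exact ⟨fun h a ha i j hij => (mem_span_pair_X_pow hij.ne t f).1 (h i j hij) a ha,
    fun h i j hij => (mem_span_pair_X_pow hij.ne t f).2 fun a ha => h a ha i j hij⟩

theorem isHomogeneous_edgePowerIntersection (G : SimpleGraph σ) (t : ℕ) :
    (edgePowerIntersection k G t).IsHomogeneous (homogeneousSubmodule σ k) := by
  intro d f hf
  change (decomposition.decompose' f d : MvPolynomial σ k) ∈ _
  rw [decomposition.decompose'_apply]
  rw [mem_edgePowerIntersection] at hf ⊢
  intro a ha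
  rw [support_homogeneousComponent] at ha
  exact hf a (Finset.mem_filter.1 ha).1

theorem degreeComponentIdeal_edgePowerIntersection (G : SimpleGraph σ) (t d : ℕ) :
    degreeComponentIdeal (edgePowerIntersection k G t) d =
      Ideal.span ((fun a => monomial a (1 : k)) ''
        {a | a.degree = d ∧ ∀ i j, G.Adj i j → t ≤ a i + a j}) := by
  apply le_antisymm
  · refine Ideal.span_le.2 fun f hf => ?_
    rw [SetLike.mem_coe, mem_ideal_span_monomial_image]
    intro a ha
    refine ⟨a, ⟨?_, mem_edgePowerIntersection.1 hf.1 a ha⟩, le_rfl⟩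
    by_contra h
    exact mem_support_iff.1 ha (hf.2.coeff_eq_zero h)
  · refine Ideal.span_le.2 ?_
    rintro _ ⟨a, ha, rfl⟩
    refine Ideal.subset_span ⟨mem_edgePowerIntersection.2 fun b hb => ?_,
      isHomogeneous_monomial _ ha.1⟩
    rw [Finset.mem_singleton.1 (support_monomial_subset hb)]
    exact ha.2

end EdgePowers

/-! ### Convex exchange for exponent vectors -/

section Exchange

variable {n : ℕ}

/-- A separable convex weight which orders the monomials of a given degree. -/
def exchangeWeight (a : Fin n →₀ ℕ) : ℤ :=
  ∑ i, (a i : ℤ) * (n * a i + (i : ℕ))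

/-- The exponent vector obtained from `b` by moving one unit from `l` to `s`. -/
noncomputable def moveUnit (b : Fin n →₀ ℕ) (s l : Fin n) : Fin n →₀ ℕ :=
  b - Finsupp.single l 1 + Finsupp.single s 1

theorem moveUnit_add_single {b : Fin n →₀ ℕ} {s l : Fin n} (hl : 1 ≤ b l) :
    moveUnit b s l + Finsupp.single l 1 = b + Finsupp.single s 1 := by
  rw [moveUnit, add_right_comm, tsub_add_cancel_of_le]
  rwa [Finsupp.single_le_iff]

theorem moveUnit_apply {b : Fin n →₀ ℕ} {s l : Fin n} (i : Fin n) :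
    moveUnit b s l i = b i - (if i = l then 1 else 0) + if i = s then 1 else 0 := by
  simp [moveUnit, Finsupp.single_apply, eq_comm]

/-- The two sides of `h` are the marginal cost of raising `b s` by one and the marginal saving of
lowering `b l` by one. -/
theorem exchangeWeight_moveUnit_lt {b : Fin n →₀ ℕ} {s l : Fin n} (hl : 1 ≤ b l)
    (h : (n : ℤ) * (2 * b s + 1) + (s : ℕ) < n * (2 * b l - 1) + (l : ℕ)) :
    exchangeWeight (moveUnit b s l) < exchangeWeight b := by
  have hsl : s ≠ l := by
    rintro rfl
    have : (0 : ℤ) ≤ n := by positivity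
    linarith
  have key : exchangeWeight (moveUnit b s l) - exchangeWeight b =
      ∑ i, ((if i = s then ((n : ℤ) * (2 * b s + 1) + (s : ℕ)) else 0) -
        if i = l then ((n : ℤ) * (2 * b l - 1) + (l : ℕ)) else 0) := by
    rw [exchangeWeight, exchangeWeight, ← Finset.sum_sub_distrib]
    refine Finset.sum_congr rfl fun i _ => ?_
    rw [moveUnit_apply]
    by_cases h1 : i = s
    · subst h1; simp [hsl]; ring
    · by_cases h2 : i = l
      · subst h2; simp [h1]; push_cast [Nat.cast_sub hl]; ring
      · simp [h1, h2]
  rw [Finset.sum_sub_distrib] at key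
  simp only [Finset.sum_ite_eq', Finset.mem_univ, if_true] at key
  linarith

/-- Otherwise let `θ` be the largest saving among coordinates with `a l < b l`. Every coordinate
with `b s < a s` costs more than `θ`, so convexity makes the weight of `a` exceed that of `b` by
more than `θ * Σ (a i - b i) = 0`. -/
theorem exists_exchange {a b : Fin n →₀ ℕ} (hdeg : a.degree = b.degree) (hne : a ≠ b)
    (hle : exchangeWeight a ≤ exchangeWeight b) :
    ∃ s l, b s < a s ∧ 1 ≤ b l ∧
      (n : ℤ) * (2 * b s + 1) + (s : ℕ) < n * (2 * b l - 1) + (l : ℕ) := by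
  by_contra! hcon
  have hsum : ∑ i, ((a i : ℤ) - b i) = 0 := by
    rw [Finsupp.degree_eq_sum, Finsupp.degree_eq_sum] at hdeg
    rw [Finset.sum_sub_distrib, sub_eq_zero]
    exact_mod_cast hdeg
  have hT : ∃ s, b s < a s := by
    by_contra! h
    refine hne (Finsupp.ext fun i => ?_)
    have := (Finset.sum_eq_zero_iff_of_nonpos (fun i _ => by have := h i; omega)).1 hsum i
      (Finset.mem_univ i)
    omega
  have hD : ∃ l, a l < b l := by
    by_contra! h
    refine hne (Finsupp.ext fun i => ?_)
    have := (Finset.sum_eq_zero_iff_of_nonneg (fun i _ => by have := h i; omega)).1 hsum i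
      (Finset.mem_univ i)
    omega
  obtain ⟨l, hl, hmax⟩ := (Finset.univ.filter fun l => a l < b l).exists_max_image
    (fun l => (n : ℤ) * (2 * b l - 1) + (l : ℕ)) (by simpa [Finset.Nonempty] using hD)
  simp only [Finset.mem_filter, Finset.mem_univ, true_and] at hl hmax
  set θ : ℤ := n * (2 * b l - 1) + (l : ℕ) with hθ
  have hstrict : ∀ s, b s < a s → θ < (n : ℤ) * (2 * b s + 1) + (s : ℕ) := by
    intro s hs
    refine lt_of_le_of_ne (hcon s l hs (by omega)) fun heq => ?_
    -- The terms `s` and `l` are residues modulo `n`, so marginal values at distinct coordinates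
    -- never coincide.
    have hmod : (l : ℕ) = (s : ℕ) := by
      have h1 := congrArg (· % (n : ℤ)) heq
      simp only [hθ, Int.mul_add_emod_self_left] at h1
      rw [Int.emod_eq_of_lt (by positivity) (by exact_mod_cast l.2),
        Int.emod_eq_of_lt (by positivity) (by exact_mod_cast s.2)] at h1
      exact_mod_cast h1
    rw [Fin.ext hmod] at hl
    omega
  have hterm : ∀ i, ((a i : ℤ) - b i) * θ ≤
      (a i : ℤ) * (n * a i + (i : ℕ)) - (b i : ℤ) * (n * b i + (i : ℕ)) := by
    intro i
    have hfac : (a i : ℤ) * (n * a i + (i : ℕ)) - (b i : ℤ) * (n * b i + (i : ℕ)) =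
      ((a i : ℤ) - b i) * (n * (a i + b i) + (i : ℕ)) := by ring
    rw [hfac]
    rcases lt_trichotomy (a i) (b i) with h | h | h
    · refine mul_le_mul_of_nonpos_left (le_trans ?_ (hmax i h)) (by omega)
      have : (n : ℤ) * (a i + b i) ≤ n * (2 * b i - 1) :=
        mul_le_mul_of_nonneg_left (by omega) (by positivity)
      linarith
    · simp [h]
    · refine mul_le_mul_of_nonneg_left (le_trans (hstrict i h).le ?_) (by omega)
      have : (n : ℤ) * (2 * b i + 1) ≤ n * (a i + b i) :=
        mul_le_mul_of_nonneg_left (by omega) (by positivity)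
      linarith
  obtain ⟨s, hs⟩ := hT
  have hlt : ∑ i, ((a i : ℤ) - b i) * θ <
      ∑ i, ((a i : ℤ) * (n * a i + (i : ℕ)) - (b i : ℤ) * (n * b i + (i : ℕ))) := by
    refine Finset.sum_lt_sum (fun i _ => hterm i) ⟨s, Finset.mem_univ s, ?_⟩
    have hfac : (a s : ℤ) * (n * a s + (s : ℕ)) - (b s : ℤ) * (n * b s + (s : ℕ)) =
      ((a s : ℤ) - b s) * (n * (a s + b s) + (s : ℕ)) := by ring
    rw [hfac]
    refine mul_lt_mul_of_pos_left (lt_of_lt_of_le (hstrict s hs) ?_) (by omega)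
    have : (n : ℤ) * (2 * b s + 1) ≤ n * (a s + b s) :=
      mul_le_mul_of_nonneg_left (by omega) (by positivity)
    linarith
  rw [← Finset.sum_mul, hsum, zero_mul, Finset.sum_sub_distrib] at hlt
  have : exchangeWeight a ≤ exchangeWeight b := hle
  simp only [exchangeWeight] at this
  linarith

/-- Since `h` forces `b s < b l`, a pair `{i, l}` with `i ≠ s` retains `b i + b l - 1 ≥ b i + b s ≥
t`, and the sum over `{s, l}` is unchanged. The bound for `{i, s}` is available because all pairs
are edges. -/
theorem le_moveUnit_apply_add_moveUnit_apply {b : Fin n →₀ ℕ} {s l : Fin n} {t : ℕ}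
    (hb : ∀ i j, i ≠ j → t ≤ b i + b j)
    (h : (n : ℤ) * (2 * b s + 1) + (s : ℕ) < n * (2 * b l - 1) + (l : ℕ))
    {i j : Fin n} (hij : i ≠ j) : t ≤ moveUnit b s l i + moveUnit b s l j := by
  have hlt : b s < b l := by
    by_contra! hcon
    have h1 : (n : ℤ) * (2 * b l + 1) ≤ n * (2 * b s + 1) :=
      mul_le_mul_of_nonneg_left (by omega) (by positivity)
    have h2 : ((l : ℕ) : ℤ) < n := by exact_mod_cast l.2
    have h3 : (0 : ℤ) ≤ ((s : ℕ) : ℤ) := by positivity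
    linarith
  have hsl : s ≠ l := fun h => by simp [h] at hlt
  have h1 := hb i j hij
  rw [moveUnit_apply, moveUnit_apply]
  by_cases hi : i = l
  · subst hi
    by_cases hj : j = s
    · subst hj; simp [hij, hij.symm]; omega
    · have := hb s j (Ne.symm hj)
      simp [hij.symm, hj, hsl.symm]; omega
  · by_cases hj : j = l
    · subst hj
      by_cases hs : i = s
      · subst hs; simp [hij, hij.symm]; omega
      · have := hb i s hs
        simp [hij, hs, hsl.symm]; omega
    · simp [hi, hj]; omega

end Exchange

/-! ### Linear quotients of the degree components -/

section Main

variable {n : ℕ}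

theorem degree_moveUnit {b : Fin n →₀ ℕ} {s l : Fin n} (hl : 1 ≤ b l) :
    (moveUnit b s l).degree = b.degree := by
  have h := congrArg Finsupp.degree (moveUnit_add_single (s := s) hl)
  simpa using h

/-- The exponents of degree `d` of the monomials in the intersection of the ideals
`⟨x_i, x_j⟩ ^ t`. -/
def StarExponent (n t d : ℕ) : Type :=
  {a : Fin n →₀ ℕ // a.degree = d ∧ ∀ i j, (⊤ : SimpleGraph (Fin n)).Adj i j → t ≤ a i + a j}

theorem finite_starExponent (n t d : ℕ) : Finite (StarExponent n t d) := by
  refine Set.Finite.subset (Finset.finite_toSet (Finset.finsuppAntidiag Finset.univ d)) ?_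
  intro a ha
  rw [Finset.mem_coe, Finset.mem_finsuppAntidiag]
  exact ⟨by rw [← ha.1, Finsupp.degree_eq_sum], Finset.subset_univ _⟩

/-- The monomials of degree `d` ordered by their weight. -/
noncomputable instance starExponentLinearOrder (n t d : ℕ) :
    LinearOrder (StarExponent n t d) :=
  have := finite_starExponent n t d
  LinearOrder.lift' (β := ℤ ×ₗ Fin _)
    -- Ties in weight are broken by an arbitrary enumeration; this is harmless, as the exchange
    -- needs only a weak inequality and lowers the weight strictly.
    (fun a => toLex (exchangeWeight a.1, Finite.equivFin (StarExponent n t d) a))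
    fun _ _ h => (Finite.equivFin (StarExponent n t d)).injective
      (congrArg Prod.snd (toLex.injective h))

theorem exchangeWeight_le_of_lt {t d : ℕ} {a b : StarExponent n t d} (h : a < b) :
    exchangeWeight a.1 ≤ exchangeWeight b.1 := by
  rcases Prod.Lex.lt_iff.1 (show (_ : ℤ ×ₗ Fin _) < _ from h) with h | h
  exacts [h.le, h.1.le]

theorem lt_of_exchangeWeight_lt {t d : ℕ} {a b : StarExponent n t d}
    (h : exchangeWeight a.1 < exchangeWeight b.1) : a < b :=
  show (_ : ℤ ×ₗ Fin _) < _ from Prod.Lex.lt_iff.2 (Or.inl h)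

theorem hasVariableColons_starExponent (k : Type*) [Field k] (n t d : ℕ) :
    HasVariableColons (fun (a : StarExponent n t d) (_ : Unit) => monomial a.1 (1 : k))
      fun b => {s | ∃ a < b, ∃ l, a.1 + Finsupp.single l 1 = b.1 + Finsupp.single s 1} := by
  classical
  intro b f
  constructor
  · intro hf
    have hle : Submodule.span (MvPolynomial (Fin n) k)
        ((fun (a : StarExponent n t d) (_ : Unit) => monomial a.1 (1 : k)) '' Set.Iio b) ≤
        Submodule.comap (LinearMap.proj () : (Unit → MvPolynomial (Fin n) k) →ₗ[_] _)
          (Ideal.span ((fun a => monomial a (1 : k)) '' ((fun a : StarExponent n t d => a.1) '' Set.Iio b))) := by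
      refine Submodule.span_le.2 ?_
      rintro _ ⟨a, ha, rfl⟩
      exact Ideal.subset_span ⟨a.1, ⟨a, ha, rfl⟩, rfl⟩
    have hf' : f * monomial b.1 1 ∈
      Ideal.span ((fun a => monomial a (1 : k)) '' ((fun a : StarExponent n t d => a.1) '' Set.Iio b)) := hle hf
    rw [mem_ideal_span_monomial_image] at hf'
    rw [mem_ideal_span_X_image]
    intro m hm
    obtain ⟨_, ⟨a, hab, rfl⟩, ham⟩ := hf' (m + b.1) (by
      rw [mem_support_iff, coeff_mul_monomial, mul_one]; exact mem_support_iff.1 hm)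
    have hab : a < b := hab
    obtain ⟨s, l, hs, hl, hlt⟩ := exists_exchange (a.2.1.trans b.2.1.symm)
      (fun h => hab.ne (Subtype.ext h)) (exchangeWeight_le_of_lt hab)
    refine ⟨s, ⟨⟨moveUnit b.1 s l, (degree_moveUnit hl).trans b.2.1, fun i j hij => ?_⟩, ?_, l,
      moveUnit_add_single hl⟩, ?_⟩
    · exact le_moveUnit_apply_add_moveUnit_apply (fun i j hij => b.2.2 i j hij) hlt hij
    · exact lt_of_exchangeWeight_lt (exchangeWeight_moveUnit_lt hl hlt)
    -- Divisibility of `m + b` by `a`, together with `b s < a s`, gives `m s ≠ 0`.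
    · have := ham s
      simp only [Finsupp.add_apply] at this
      omega
  · intro hf
    induction hf using Submodule.span_induction with
    | zero => simp
    | add x y _ _ hx hy => rw [add_smul]; exact Submodule.add_mem _ hx hy
    | smul a x _ hx => rw [smul_assoc]; exact Submodule.smul_mem _ _ hx
    | mem x hx =>
      obtain ⟨s, ⟨a, hab, l, h⟩, rfl⟩ := hx
      have : (X s : MvPolynomial (Fin n) k) • (fun _ : Unit => monomial b.1 (1 : k)) =
          (X l : MvPolynomial (Fin n) k) • fun _ : Unit => monomial a.1 (1 : k) := by
        funext
        simp only [Pi.smul_apply, smul_eq_mul, X, monomial_mul, mul_one]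
        rw [add_comm, ← h, add_comm]
      rw [this]
      exact Submodule.smul_mem _ _ (Submodule.subset_span ⟨a, hab, rfl⟩)

/-- The sequence of the monomials of degree `d` in the intersection of the ideals
`⟨x_i, x_j⟩ ^ t`. -/
noncomputable def starMonomialSequence (k : Type*) [Field k] (n t d : ℕ) :
    VariableColonSequence k (Fin n) where
  coord := Unit
  index := StarExponent n t d
  fintypeIndex := have := finite_starExponent n t d; Fintype.ofFinite _
  deg := d
  elt a _ := monomial a.1 1
  colon b := {s | ∃ a < b, ∃ l, a.1 + Finsupp.single l 1 = b.1 + Finsupp.single s 1}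
  isHomogeneous_elt a _ := isHomogeneous_monomial _ a.2.1
  hasVariableColons := hasVariableColons_starExponent k n t d

end Main

theorem mainTheorem1 {k : Type*} [Field k] (n t : ℕ) (hn : 3 ≤ n) (ht : 1 ≤ t) :
    IsComponentwiseLinear (edgePowerIntersection k (⊤ : SimpleGraph (Fin n)) t) := by
  refine ⟨isHomogeneous_edgePowerIntersection _ t, fun d => ?_⟩
  refine (starMonomialSequence k n t d).hasLinearResolution () (fun _ => rfl) ?_
  rw [degreeComponentIdeal_edgePowerIntersection, Set.image_eq_range]
  rfl
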